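/- Let $m\ge 1$ and let $F:\mathbb{R}^n\to\mathbb{R}^m$, $H:\mathbb{R}^n\to\mathbb{R}^{m_H}$, $G:\mathbb{R}^n\to\mathbb{R}^{m_G}$ be $C^2$. Put $\mathcal M=H^{-1}(0)$, $\mathcal N=\{x\in\mathcal M: G_i(x)\le 0\ \forall i\}$, $I_\epsilon(x)=\{i: G_i(x)\ge-\epsilon\}$ for $\epsilon\ge 0$, and $\mathcal M_I=\{x\in\mathcal M: G_i(x)=0\ \forall i\in I\}$. Assume that $DH(x)$ has rank $m_H$ for all $x\in\mathcal M$, and that for every $x\in\mathcal N$ there is $v\in\ker DH(x)$ with $\nabla G_i(x)v<0$ for all $i\in I_0(x)$, and the vectors $\nabla H_1(x),\dots,\nabla H_{m_H}(x)$, $\nabla G_i(x)$ ($i\in I_0(x)$) are linearly independent. Let $\pi$ and $\pi_I$ (for $\mathcal M_I\ne\emptyset$) be maps on $\mathbb{R}^n$ that send each $y$ to a point of $\mathcal M$, respectively $\mathcal M_I$, of minimal Euclidean distance to $y$ (an arbitrary choice where it is not unique). Let $\alpha_1(x,\epsilon)$ be the minimum of $\beta+\frac12\|v\|^2$ over $(v,\beta)\in\mathbb{R}^{n+1}$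 subject to $$\nabla F_i(x)v\le\beta\ (1\le i\le m),\quad \nabla G_l(x)v\le\beta\ (l\in I_\epsilon(x)),\quad DH(x)v=0, \tag{SP1}$$ and $\alpha_2(x)$ the minimum of the same function subject to $$\nabla F_i(x)v\le\beta\ (1\le i\le m),\quad DH(x)v=0,\quad \nabla G_l(x)v=0\ (l\in I_0(x)). \tag{SP2}$$ Vector inequalities are meant in every component. For a map $p$, points $x,v$ and $t>0$, say that $t$ satisfies the Armijo condition for $p$ at $(x,v)$ if $F(p(x+tv))<F(x)+\sigma t\,DF(x)v$. Algorithm. Given $x\in\mathbb{R}^n$, $\beta_0>0$, $\beta\in(0,1)$, $\sigma\in(0,1)$, $\epsilon>0$, $\eta>0$, let $x_0$ be a point of $\mathcal N$ nearest to $x$. For $l=0,1,\dots$: 1. If $\alpha_2(x_l)>-\eta$: if $\alpha_1(x_l,\epsilon)=0$, stop. Otherwise let $v_l$ be the solution of (SP1) at $x_l$, and let $k_l$ be the smallest $k\in\mathbb{N}_0$ for which $\beta_0\beta^k$ satisfies the Armijo condition for $\pi$ at $(x_l,v_l)$. If $\pi(x_l+\beta_0\beta^{k_l}v_l)\in\mathcal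 N$, let $t_l=\beta_0\beta^{k_l}$. If not, let $k$ be the smallest exponent for which $\beta_0\beta^k$ satisfies this Armijo condition and $\pi(x_l+\beta_0\beta^kv_l)\in\mathcal N$, and choose any $t_l\in[\beta_0\beta^k,\beta_0\beta^{k_l}]$ that satisfies the Armijo condition and $\pi(x_l+t_lv_l)\in\mathcal N$. Set $x_{l+1}=\pi(x_l+t_lv_l)$. 2. If $\alpha_2(x_l)\le-\eta$: let $I=I_0(x_l)$, let $v_l$ be the solution of (SP2) at $x_l$, and let $k_l$ be the smallest $k\in\mathbb{N}_0$ for which $\beta_0\beta^k$ satisfies the Armijo condition for $\pi_I$ at $(x_l,v_l)$. If $\pi_I(x_l+\beta_0\beta^{k_l}v_l)\in\mathcal N$, let $t_l=\beta_0\beta^{k_l}$. If not, choose any $t_l\in(0,\beta_0\beta^{k_l})$ that satisfies the Armijo condition for $\pi_I$, with $\pi_I(x_l+t_lv_l)\in\mathcal N$ and $|I_0(\pi_I(x_l+t_lv_l))|>|I_0(x_l)|$. Set $x_{l+1}=\pi_I(x_l+t_lv_l)$. Theorem. Let $(x_l)_l$ be a sequence generated by this algorithm, either infinite, or finite and ended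 by the stopping criterion. Then $\alpha_1(\bar x,\epsilon)=0$ for every accumulation point $\bar x$ of $(x_l)_l$ or, if $(x_l)_l$ is finite, for its last element $\bar x$. -/

import Mathlib

open Filter Topology

noncomputable section

/-- Euclidean space `ℝⁿ` with the Euclidean norm. -/
abbrev Eucl (n : ℕ) : Type := EuclideanSpace ℝ (Fin n)

/-- The data of the multiobjective optimization problem
`min F(x)` subject to `H(x) = 0`, `G(x) ≤ 0` on `ℝⁿ`. -/
structure MOP (n m mH mG : ℕ) where
  F : Eucl n → (Fin m → ℝ)
  H : Eucl n → (Fin mH → ℝ)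
  G : Eucl n → (Fin mG → ℝ)

namespace MOP

variable {n m mH mG : ℕ} (P : MOP n m mH mG)

/-- `∇F_i(x) v`. -/
def dF (x v : Eucl n) (i : Fin m) : ℝ := fderiv ℝ P.F x v i

/-- `∇H_j(x) v`. -/
def dH (x v : Eucl n) (j : Fin mH) : ℝ := fderiv ℝ P.H x v j

/-- `∇G_l(x) v`. -/
def dG (x v : Eucl n) (l : Fin mG) : ℝ := fderiv ℝ P.G x v l

/-- The manifold `M = H⁻¹(0)`. -/
def M : Set (Eucl n) := {x | P.H x = 0}

/-- The feasible set `N = M ∩ {G ≤ 0}`. -/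
def N : Set (Eucl n) := {x | x ∈ P.M ∧ ∀ l, P.G x l ≤ 0}

/-- The active set `I_ε(x) = {l : G_l(x) ≥ -ε}`. -/
def active (ε : ℝ) (x : Eucl n) : Finset (Fin mG) :=
  Finset.univ.filter fun l => -ε ≤ P.G x l

/-- `M_I = M ∩ ⋂_{l ∈ I} G_l⁻¹(0)`. -/
def MI (I : Finset (Fin mG)) : Set (Eucl n) := {x | x ∈ P.M ∧ ∀ l ∈ I, P.G x l = 0}

/-- `0` is a regular value of `H`. -/
def RegularH : Prop := ∀ x ∈ P.M, Function.Surjective (fderiv ℝ P.H x)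

/-- At every feasible point the linearized cone has nonempty (relative) interior. -/
def LinearizedConeInterior : Prop :=
  ∀ x ∈ P.N, ∃ v : Eucl n, (∀ j, P.dH x v j = 0) ∧ ∀ l ∈ P.active 0 x, P.dG x v l < 0

/-- At every feasible point the gradients of the equality constraints and of the active inequality
constraints, as row vectors (i.e. as linear functionals), are linearly independent. -/
def LinearIndependentGradients : Prop :=
  ∀ x ∈ P.N, LinearIndependent ℝ
    (Sum.elim (fun j : Fin mH => fderiv ℝ (fun y => P.H y j) x)
      (fun l : {l : Fin mG // l ∈ P.active 0 x} => fderiv ℝ (fun y => P.G y l) x))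

/-- The objective `β + ½ ‖v‖²` of the subproblems, as a function of `(v, β)`. -/
def spObj (p : Eucl n × ℝ) : ℝ := p.2 + ‖p.1‖ ^ 2 / 2

/-- The constraints of subproblem (SP1) at `x` with tolerance `ε`. -/
def sp1Feasible (x : Eucl n) (ε : ℝ) : Set (Eucl n × ℝ) :=
  {p | (∀ i, P.dF x p.1 i ≤ p.2) ∧ (∀ l ∈ P.active ε x, P.dG x p.1 l ≤ p.2) ∧
    ∀ j, P.dH x p.1 j = 0}

/-- The constraints of subproblem (SP2) at `x`. -/
def sp2Feasible (x : Eucl n) : Set (Eucl n × ℝ) :=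
  {p | (∀ i, P.dF x p.1 i ≤ p.2) ∧ (∀ j, P.dH x p.1 j = 0) ∧
    ∀ l ∈ P.active 0 x, P.dG x p.1 l = 0}

/-- The optimal value `α₁(x, ε)` of (SP1). -/
def alpha1 (x : Eucl n) (ε : ℝ) : ℝ := sInf (spObj '' P.sp1Feasible x ε)

/-- The optimal value `α₂(x)` of (SP2). -/
def alpha2 (x : Eucl n) : ℝ := sInf (spObj '' P.sp2Feasible x)

/-- `v` is (the direction part of) a solution of (SP1) at `x` with tolerance `ε`. -/
def IsSolSP1 (x : Eucl n) (ε : ℝ) (v : Eucl n) : Prop :=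
  ∃ b : ℝ, (v, b) ∈ P.sp1Feasible x ε ∧ IsMinOn spObj (P.sp1Feasible x ε) (v, b)

/-- `v` is (the direction part of) a solution of (SP2) at `x`. -/
def IsSolSP2 (x : Eucl n) (v : Eucl n) : Prop :=
  ∃ b : ℝ, (v, b) ∈ P.sp2Feasible x ∧ IsMinOn spObj (P.sp2Feasible x) (v, b)

end MOP

/-- `p` maps every point `y` to a point of `S` of minimal Euclidean distance to `y`
(*some* such point, wherever it is not unique). -/
def IsProjectionOnto {n : ℕ} (S : Set (Eucl n)) (p : Eucl n → Eucl n) : Prop :=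
  ∀ y, p y ∈ S ∧ ∀ z ∈ S, ‖p y - y‖ ≤ ‖z - y‖

/-- The parameters of the algorithm. -/
structure AlgParams where
  β₀ : ℝ
  β : ℝ
  σ : ℝ
  ε : ℝ
  η : ℝ

namespace MOP

variable {n m mH mG : ℕ} (P : MOP n m mH mG)

/-- The Armijo inequality `F(p(x + t v)) < F(x) + σ t DF(x) v` (in every component). -/
def Armijo (σ : ℝ) (p : Eucl n → Eucl n) (x v : Eucl n) (t : ℝ) : Prop :=
  ∀ i, P.F (p (x + t • v)) i < P.F x i + σ * t * P.dF x v i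

/-- `t` is an admissible step length of Strategy 1 at `x` in direction `v`: the Armijo step length
`β₀ β ^ k₀`, if it leads to a feasible point; otherwise any `t` between `β₀ β ^ k` and `β₀ β ^ k₀`
that leads to a feasible point and satisfies the Armijo inequality, where `k` is the smallest
exponent for which both of these hold. -/
def IsStep1 (A : AlgParams) (π : Eucl n → Eucl n) (x v : Eucl n) (t : ℝ) : Prop :=
  ∃ k₀ : ℕ, IsLeast {k : ℕ | P.Armijo A.σ π x v (A.β₀ * A.β ^ k)} k₀ ∧
    ((π (x + (A.β₀ * A.β ^ k₀) • v) ∈ P.N ∧ t = A.β₀ * A.β ^ k₀) ∨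
     (π (x + (A.β₀ * A.β ^ k₀) • v) ∉ P.N ∧
      ∃ k : ℕ, IsLeast {k : ℕ | P.Armijo A.σ π x v (A.β₀ * A.β ^ k) ∧
          π (x + (A.β₀ * A.β ^ k) • v) ∈ P.N} k ∧
        t ∈ Set.Icc (A.β₀ * A.β ^ k) (A.β₀ * A.β ^ k₀) ∧
        π (x + t • v) ∈ P.N ∧ P.Armijo A.σ π x v t))

/-- `t` is an admissible step length of Strategy 2 at `x` in direction `v`, where `q` is the
projection onto `M_I` with `I = I_0(x)`: the Armijo step length `β₀ β ^ k₀`, if it leads to a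
feasible point; otherwise any smaller `t > 0` that leads to a feasible point with more active
inequalities and satisfies the Armijo inequality. -/
def IsStep2 (A : AlgParams) (q : Eucl n → Eucl n) (x v : Eucl n) (t : ℝ) : Prop :=
  ∃ k₀ : ℕ, IsLeast {k : ℕ | P.Armijo A.σ q x v (A.β₀ * A.β ^ k)} k₀ ∧
    ((q (x + (A.β₀ * A.β ^ k₀) • v) ∈ P.N ∧ t = A.β₀ * A.β ^ k₀) ∨
     (q (x + (A.β₀ * A.β ^ k₀) • v) ∉ P.N ∧
        0 < t ∧ t < A.β₀ * A.β ^ k₀ ∧ q (x + t • v) ∈ P.N ∧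
        (P.active 0 x).card < (P.active 0 (q (x + t • v))).card ∧
        P.Armijo A.σ q x v t))

/-- One iteration of the algorithm at the point `x`. The outcome is `none` if the algorithm stops
at `x`, and `some y` if it moves on to `y`. -/
inductive Iteration (A : AlgParams) (π : Eucl n → Eucl n)
    (πI : Finset (Fin mG) → Eucl n → Eucl n) : Eucl n → Option (Eucl n) → Prop
  | terminate (x : Eucl n) (h₂ : -A.η < P.alpha2 x) (h₁ : P.alpha1 x A.ε = 0) :
      Iteration A π πI x none
  | strategy1 (x v : Eucl n) (t : ℝ) (h₂ : -A.η < P.alpha2 x) (h₁ : P.alpha1 x A.ε ≠ 0)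
      (hv : P.IsSolSP1 x A.ε v) (ht : P.IsStep1 A π x v t) :
      Iteration A π πI x (some (π (x + t • v)))
  | strategy2 (x v : Eucl n) (t : ℝ) (h₂ : P.alpha2 x ≤ -A.η)
      (hv : P.IsSolSP2 x v) (ht : P.IsStep2 A (πI (P.active 0 x)) x v t) :
      Iteration A π πI x (some (πI (P.active 0 x) (x + t • v)))

/-- `x₀` is a possible initial iterate for the input `z`: a feasible point nearest to `z`. -/
def IsInitial (z x₀ : Eucl n) : Prop := x₀ ∈ P.N ∧ ∀ y ∈ P.N, ‖z - x₀‖ ≤ ‖z - y‖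

/-- The algorithm with input `z` can generate the infinite sequence `x 0, x 1, …`. -/
def GeneratesInfinite (A : AlgParams) (π : Eucl n → Eucl n)
    (πI : Finset (Fin mG) → Eucl n → Eucl n) (z : Eucl n) (x : ℕ → Eucl n) : Prop :=
  P.IsInitial z (x 0) ∧ ∀ l, P.Iteration A π πI (x l) (some (x (l + 1)))

/-- The algorithm with input `z` can generate the finite sequence `x 0, …, x L` and stop there. -/
def GeneratesFinite (A : AlgParams) (π : Eucl n → Eucl n)
    (πI : Finset (Fin mG) → Eucl n → Eucl n) (z : Eucl n) (x : ℕ → Eucl n) (L : ℕ) : Prop :=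
  P.IsInitial z (x 0) ∧ (∀ l < L, P.Iteration A π πI (x l) (some (x (l + 1)))) ∧
    P.Iteration A π πI (x L) none

end MOP

end

/-! Suppose `alpha1` is nonzero at an accumulation point `a`. Every `F i` is nonincreasing along the
iterates and has a cluster value, so its decrements tend to zero. Near `a`, however, progress is
uniform. The optimal value of (SP1) stays below a fixed `-δ` (`eventually_spObj_le`), that of (SP2)
is at most `-η` whenever it is used, and the directions are bounded. By metric regularity of the
constraints, projecting costs only `o(t)`, uniformly near `a`; hence all small steps satisfy Armijo
and, in Strategy 1, stay feasible, and backtracking bounds the step lengths below.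

The only exception is a truncated Strategy 2 step that is too short. It stays near `a` and activates
a further constraint (`eventually_iteration_decrease`). As fixed decreases eventually cease,
frequent visits near `a` with `c` active constraints force frequent visits with `c + 1`, and
induction exceeds the number of constraints. A finite run ends only through the stopping test. -/

/-! ### Uniform first-order expansions and metric regularity -/

section Regularity

variable {E F : Type*} [NormedAddCommGroup E] [NormedSpace ℝ E] [NormedAddCommGroup F]
  [NormedSpace ℝ F]

/-- Uniform first-order expansion of a `C¹` map along curves that are tangent to straight lines. -/
theorem ContDiff.eventually_norm_sub_sub_smul_fderiv_le {f : E → F} (hf : ContDiff ℝ 1 f) (a : E)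
    {κ R : ℝ} (hκ : 0 < κ) (hR : 0 < R) :
    ∃ τ > 0, ∀ᶠ x in 𝓝 a, ∀ v, ‖v‖ ≤ R → ∀ t, 0 < t → t ≤ τ → ∀ z,
      ‖z - (x + t • v)‖ ≤ τ * t → ‖f z - f x - t • fderiv ℝ f x v‖ ≤ κ * t := by
  have hs : HasStrictFDerivAt f (fderiv ℝ f a) a :=
    hf.contDiffAt.hasStrictFDerivAt (by norm_num)
  have hb := hs.isLittleO.def (show 0 < κ / (3 * (R + 1)) by positivity)
  obtain ⟨r, hr, hball⟩ := Metric.eventually_nhds_iff.1 hb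
  have hc : ∀ᶠ x in 𝓝 a, ‖fderiv ℝ f a - fderiv ℝ f x‖ < κ / (3 * R) := by
    have h : ContinuousAt (fun x => ‖fderiv ℝ f a - fderiv ℝ f x‖) a :=
      (continuousAt_const.sub (hf.continuous_fderiv (by norm_num)).continuousAt).norm
    exact h.eventually_lt continuousAt_const (by simpa using (by positivity))
  set L := ‖fderiv ℝ f a‖
  have hL : 0 ≤ L := norm_nonneg _
  -- The bound `1` gives `‖z - x‖ ≤ (R + 1) t`, the second makes the offset from the line cost at
  -- most `κ t / 3`, the third keeps `z` in the ball of strict differentiability.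
  refine ⟨min 1 (min (κ / (3 * (L + 1))) (r / (4 * (R + 1)))), by positivity, ?_⟩
  filter_upwards [hc, Metric.ball_mem_nhds a (half_pos hr)] with x hx hxa v hv t ht htτ z hz
  set τ := min 1 (min (κ / (3 * (L + 1))) (r / (4 * (R + 1))))
  have hτ1 : τ ≤ 1 := min_le_left _ _
  have hτ2 : τ * (3 * (L + 1)) ≤ κ := by
    rw [← le_div_iff₀ (by positivity)]
    exact (min_le_right _ _).trans (min_le_left _ _)
  have hτ3 : τ * (4 * (R + 1)) ≤ r := by
    rw [← le_div_iff₀ (by positivity)]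
    exact (min_le_right _ _).trans (min_le_right _ _)
  have htv : ‖t • v‖ ≤ R * t := by
    rw [norm_smul, Real.norm_of_nonneg ht.le, mul_comm]
    gcongr
  have hzx : ‖z - x‖ ≤ (R + 1) * t := by
    have h : z - x = (z - (x + t • v)) + t • v := by abel
    rw [h]
    refine (norm_add_le _ _).trans ?_
    nlinarith
  have hxa' : ‖x - a‖ < r / 2 := by simpa [dist_eq_norm] using hxa
  have hza : ‖z - a‖ < r := by
    have h : z - a = (z - x) + (x - a) := by abel
    rw [h]
    refine (norm_add_le _ _).trans_lt ?_
    nlinarith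
  have h1 := hball (y := (z, x)) (by
    rw [Prod.dist_eq, dist_eq_norm, dist_eq_norm]
    exact max_lt hza (by linarith))
  have e : f z - f x - t • fderiv ℝ f x v = (f z - f x - fderiv ℝ f a (z - x))
      + fderiv ℝ f a (z - (x + t • v)) + (fderiv ℝ f a - fderiv ℝ f x) (t • v) := by
    simp only [map_sub, map_add, sub_apply, map_smul, smul_sub]
    abel
  rw [e]
  refine (norm_add₃_le).trans ?_
  have b1 : ‖f z - f x - fderiv ℝ f a (z - x)‖ ≤ κ / 3 * t := by
    refine h1.trans ?_
    calc κ / (3 * (R + 1)) * ‖z - x‖ ≤ κ / (3 * (R + 1)) * ((R + 1) * t) := by gcongr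
      _ = κ / 3 * t := by field_simp
  have b2 : ‖fderiv ℝ f a (z - (x + t • v))‖ ≤ κ / 3 * t := by
    refine ((fderiv ℝ f a).le_opNorm _).trans ?_
    calc L * ‖z - (x + t • v)‖ ≤ (L + 1) * (τ * t) := by gcongr; linarith
      _ ≤ κ / 3 * t := by nlinarith
  have b3 : ‖(fderiv ℝ f a - fderiv ℝ f x) (t • v)‖ ≤ κ / 3 * t := by
    refine (ContinuousLinearMap.le_opNorm _ _).trans ?_
    calc ‖fderiv ℝ f a - fderiv ℝ f x‖ * ‖t • v‖ ≤ κ / (3 * R) * (R * t) := by gcongr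
      _ = κ / 3 * t := by field_simp
  linarith

/-- Metric regularity of a submersion near a zero. -/
theorem HasStrictFDerivAt.exists_zero_norm_sub_le [CompleteSpace E] [CompleteSpace F]
    {K : E → F} {K' : E →L[ℝ] F} {a : E} (hK : HasStrictFDerivAt K K' a)
    (hsurj : Function.Surjective K') (ha : K a = 0) :
    ∃ C > 0, ∀ᶠ y in 𝓝 a, ∃ z, K z = 0 ∧ ‖z - y‖ ≤ C * ‖K y‖ := by
  have hr : K'.range = ⊤ := LinearMap.range_eq_top.2 hsurj
  let S := K'.nonlinearRightInverseOfSurjective hr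
  have hS : 0 < S.nnnorm := K'.nonlinearRightInverseOfSurjective_nnnorm_pos hr
  -- Half of `S.nnnorm⁻¹` is left as covering rate, so a ball of radius `2 ‖S‖ ‖K y‖` about `y` has
  -- an image reaching from `K y` to `0`.
  obtain ⟨s, hs, happ⟩ := hK.approximates_deriv_on_nhds (c := S.nnnorm⁻¹ / 2)
    (Or.inr (by positivity))
  obtain ⟨r, hr0, hrs⟩ := Metric.mem_nhds_iff.1 hs
  have hS' : (0 : ℝ) < S.nnnorm := hS
  refine ⟨2 * S.nnnorm, by positivity, ?_⟩
  have hc : ∀ᶠ y in 𝓝 a, 2 * S.nnnorm * ‖K y‖ < r / 2 := by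
    have h : ContinuousAt (fun y => 2 * (S.nnnorm : ℝ) * ‖K y‖) a :=
      continuousAt_const.mul hK.continuousAt.norm
    exact h.eventually_lt continuousAt_const (by simpa [ha] using hr0)
  filter_upwards [hc, Metric.ball_mem_nhds a (half_pos hr0)] with y hy hya
  have hsub : Metric.closedBall y (2 * S.nnnorm * ‖K y‖) ⊆ s := by
    refine fun w hw => hrs ?_
    rw [Metric.mem_closedBall] at hw
    rw [Metric.mem_ball] at hya ⊢
    linarith [dist_triangle w y a]
  obtain ⟨z, hz, hz0⟩ := happ.surjOn_closedBall_of_nonlinearRightInverse S (by positivity) hsub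
    (show (0 : F) ∈ _ by
      rw [Metric.mem_closedBall, dist_eq_norm, zero_sub, norm_neg]
      push_cast
      refine le_of_eq ?_
      field_simp
      ring)
  exact ⟨z, hz0, by simpa [dist_eq_norm] using hz⟩

/-- Near a zero of a submersion, a nearest-point map onto the zero set is tangent to the identity
along tangent directions, so it does not affect first-order expansions. -/
theorem ContDiff.eventually_abs_sub_sub_fderiv_le_of_proj [CompleteSpace E] [CompleteSpace F]
    {K : E → F} (hK : ContDiff ℝ 1 K) {a : E} (hsurj : Function.Surjective (fderiv ℝ K a))
    (ha : K a = 0) {p : E → E} (hp : ∀ y z, K z = 0 → ‖p y - y‖ ≤ ‖z - y‖)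
    {f : E → ℝ} (hf : ContDiff ℝ 1 f) {κ R : ℝ} (hκ : 0 < κ) (hR : 0 < R) :
    ∃ τ > 0, ∀ᶠ x in 𝓝 a, K x = 0 → ∀ v, ‖v‖ ≤ R → fderiv ℝ K x v = 0 →
      ∀ t, 0 < t → t ≤ τ → |f (p (x + t • v)) - f x - t * fderiv ℝ f x v| ≤ κ * t := by
  obtain ⟨τ₁, hτ₁, h₁⟩ := hf.eventually_norm_sub_sub_smul_fderiv_le a hκ hR
  have hs : HasStrictFDerivAt K (fderiv ℝ K a) a :=
    hK.contDiffAt.hasStrictFDerivAt (by norm_num)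
  obtain ⟨C, hC, h₂⟩ := hs.exists_zero_norm_sub_le hsurj ha
  -- Tangency gives `‖K (x + t • v)‖ ≤ (τ₁ / C) t`; regularity multiplies this by `C`, which is just
  -- the offset `τ₁ t` that the expansion of `f` tolerates.
  obtain ⟨τ₂, hτ₂, h₃⟩ := hK.eventually_norm_sub_sub_smul_fderiv_le a (div_pos hτ₁ hC) hR
  obtain ⟨r, hr, hball⟩ := Metric.eventually_nhds_iff.1 h₂
  refine ⟨min τ₁ (min τ₂ (r / (4 * R))), by positivity, ?_⟩
  filter_upwards [h₁, h₃, Metric.ball_mem_nhds a (half_pos hr)] with x hx₁ hx₃ hxa hKx v hv hKv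
    t ht htτ
  have ht₁ : t ≤ τ₁ := htτ.trans (min_le_left _ _)
  have ht₂ : t ≤ τ₂ := htτ.trans ((min_le_right _ _).trans (min_le_left _ _))
  have ht₃ : t * (4 * R) ≤ r := by
    rw [← le_div_iff₀ (by positivity)]
    exact htτ.trans ((min_le_right _ _).trans (min_le_right _ _))
  refine hx₁ v hv t ht ht₁ _ ?_
  have hKy : ‖K (x + t • v)‖ ≤ τ₁ / C * t := by
    have := hx₃ v hv t ht ht₂ (x + t • v) (by simpa using by positivity)
    simpa [hKx, hKv] using this
  have htv : ‖t • v‖ ≤ t * R := by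
    rw [norm_smul, Real.norm_of_nonneg ht.le]
    gcongr
  obtain ⟨z, hz0, hz⟩ := hball (y := x + t • v) (by
    rw [dist_eq_norm]
    have hxa' : ‖x - a‖ < r / 2 := by simpa [dist_eq_norm] using hxa
    have h : x + t • v - a = (x - a) + t • v := by abel
    rw [h]
    refine (norm_add_le _ _).trans_lt ?_
    linarith)
  calc _ ≤ ‖z - (x + t • v)‖ := hp _ _ hz0
    _ ≤ C * ‖K (x + t • v)‖ := hz
    _ ≤ C * (τ₁ / C * t) := by gcongr
    _ = τ₁ * t := by field_simp

/-- A vector in the kernel of a surjective derivative extends to nearby kernels. -/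
theorem ContDiff.exists_continuousAt_ker_fderiv [FiniteDimensional ℝ F] [CompleteSpace F]
    {K : E → F} (hK : ContDiff ℝ 1 K) {a : E} (hsurj : Function.Surjective (fderiv ℝ K a))
    {w : E} (hw : fderiv ℝ K a w = 0) :
    ∃ W : E → E, ContinuousAt W a ∧ W a = w ∧ ∀ᶠ x in 𝓝 a, fderiv ℝ K x (W x) = 0 := by
  obtain ⟨S, hS⟩ := (fderiv ℝ K a).exists_rightInverse_of_surjective
    (LinearMap.range_eq_top.2 hsurj)
  have hD : ContinuousAt (fderiv ℝ K) a := (hK.continuous_fderiv (by norm_num)).continuousAt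
  let T : E → F →L[ℝ] F := fun x => (fderiv ℝ K x).comp S
  have hT : ContinuousAt T a := hD.clm_comp continuousAt_const
  have hTa : T a = 1 := hS
  have hu : ∀ᶠ x in 𝓝 a, IsUnit (T x) :=
    hT.eventually_mem (Units.isOpen.mem_nhds (by rw [hTa]; exact isUnit_one))
  have hinv : ContinuousAt (fun x => Ring.inverse (T x)) a := by
    refine ContinuousAt.comp (g := Ring.inverse) ?_ hT
    rw [hTa]
    exact NormedRing.inverse_continuousAt 1
  -- `S ∘ (T x)⁻¹` is a right inverse of the derivative at `x`, used to remove the component of `w`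
  -- outside its kernel.
  refine ⟨fun x => w - S (Ring.inverse (T x) (fderiv ℝ K x w)), ?_, by simp [hw], ?_⟩
  · exact continuousAt_const.sub (S.continuous.continuousAt.comp
      (hinv.clm_apply (hD.clm_apply continuousAt_const)))
  · filter_upwards [hu] with x hx
    have h : T x * Ring.inverse (T x) = 1 := Ring.mul_inverse_cancel _ hx
    have h' : fderiv ℝ K x (S (Ring.inverse (T x) (fderiv ℝ K x w))) = fderiv ℝ K x w :=
      DFunLike.congr_fun h (fderiv ℝ K x w)
    rw [map_sub, h', sub_self]

end Regularity

/-! ### Linear independence, backtracking and monotone sequences -/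

/-- Linearly independent functionals are jointly surjective. -/
theorem LinearIndependent.surjective_pi {ι E : Type*} [Finite ι] [NormedAddCommGroup E]
    [NormedSpace ℝ E] {g : ι → E →L[ℝ] ℝ} (hg : LinearIndependent ℝ g) :
    Function.Surjective (fun v i => g i v : E → ι → ℝ) := by
  classical
  have := Fintype.ofFinite ι
  let T : E →ₗ[ℝ] ι → ℝ := LinearMap.pi fun i => (g i : E →ₗ[ℝ] ℝ)
  by_contra hns
  have hlt : LinearMap.range T < ⊤ := by
    rw [lt_top_iff_ne_top, Ne, LinearMap.range_eq_top]
    exact hns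
  obtain ⟨φ, hφ, hle⟩ := Submodule.exists_le_ker_of_lt_top _ hlt
  -- A nonzero functional vanishing on the range is a linear relation among the `g i`.
  have hsum : ∑ i, φ (Pi.single i 1) • g i = 0 := by
    ext v
    have h : φ (T v) = 0 := hle ⟨v, rfl⟩
    rw [pi_eq_sum_univ' (T v)] at h
    simpa [T, mul_comm] using h
  have h0 := Fintype.linearIndependent_iff.1 hg _ hsum
  exact hφ (LinearMap.pi_ext' fun i => LinearMap.ext_ring (by simpa using h0 i))

/-- Backtracking stops no later than one reduction below a threshold of acceptance. -/
theorem IsLeast.min_le_mul_pow {Q : ℝ → Prop} {b₀ b τ : ℝ} (hb₀ : 0 < b₀) (hb : 0 < b)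
    {k : ℕ} (hk : IsLeast {k : ℕ | Q (b₀ * b ^ k)} k) (hQ : ∀ t, 0 < t → t ≤ τ → Q t) :
    min b₀ (b * τ) ≤ b₀ * b ^ k := by
  cases k with
  | zero => simp
  | succ j =>
    by_contra! h
    have h1 : b₀ * b ^ j ≤ τ := by
      have h2 : b * (b₀ * b ^ j) < b * τ := by
        calc b * (b₀ * b ^ j) = b₀ * b ^ (j + 1) := by ring
          _ < b * τ := h.trans_le (min_le_right _ _)
      exact (lt_of_mul_lt_mul_left h2 hb.le).le
    have h3 := hk.2 (show j ∈ {k : ℕ | Q (b₀ * b ^ k)} from hQ _ (by positivity) h1)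
    omega

theorem exists_pos_forall_le {ι : Type*} [Finite ι] {τ : ι → ℝ} (h : ∀ i, 0 < τ i) :
    ∃ τ₀ > 0, ∀ i, τ₀ ≤ τ i := by
  obtain ⟨t, ht, ht0⟩ := ((eventually_all.2 fun i => Ioc_mem_nhdsGT (h i)).and
    (self_mem_nhdsWithin (s := Set.Ioi (0 : ℝ)))).exists
  exact ⟨t, ht0, fun i => (ht i).2⟩

/-- The decrements of an antitone real sequence with a cluster point tend to zero. -/
theorem Antitone.eventually_sub_succ_lt {s : ℕ → ℝ} (hs : Antitone s) {b : ℝ}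
    (hb : MapClusterPt b atTop s) {ρ : ℝ} (hρ : 0 < ρ) : ∀ᶠ l in atTop, s l - s (l + 1) < ρ := by
  have hle : ∀ l, b ≤ s l := by
    intro l
    by_contra! h
    obtain ⟨k, hk, hlk⟩ := (((mapClusterPt_iff_frequently.1 hb) _ (Ioi_mem_nhds h)).and_eventually
      (eventually_ge_atTop l)).exists
    exact absurd hk (not_lt.2 (hs hlk))
  obtain ⟨k, hk⟩ := ((mapClusterPt_iff_frequently.1 hb) _
    (Iio_mem_nhds (show b < b + ρ by linarith))).exists
  filter_upwards [eventually_ge_atTop k] with l hl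
  have h1 : s k < b + ρ := hk
  linarith [hs hl, hle (l + 1)]

/-! ### Constraint maps and active sets -/

namespace MOP

variable {n m mH mG : ℕ} {P : MOP n m mH mG}

/-- The equality constraints together with the inequality constraints indexed by `I`, as one map. -/
def constraintMap (P : MOP n m mH mG) (I : Finset (Fin mG)) (x : Eucl n) :
    Fin mH ⊕ {l // l ∈ I} → ℝ :=
  Sum.elim (P.H x) fun l => P.G x l

theorem constraintMap_eq_zero_iff {I : Finset (Fin mG)} {x : Eucl n} :
    P.constraintMap I x = 0 ↔ x ∈ P.MI I := by
  simp [constraintMap, MI, M, funext_iff]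

theorem contDiff_constraintMap (hH : ContDiff ℝ 1 P.H) (hG : ContDiff ℝ 1 P.G)
    (I : Finset (Fin mG)) : ContDiff ℝ 1 (P.constraintMap I) := by
  refine contDiff_pi.2 fun i => ?_
  cases i with
  | inl j => exact contDiff_pi.1 hH j
  | inr l => exact contDiff_pi.1 hG l

theorem fderiv_comp_apply {k : ℕ} {f : Eucl n → Fin k → ℝ} (hf : ContDiff ℝ 1 f) (x v : Eucl n)
    (i : Fin k) : fderiv ℝ (fun y => f y i) x v = fderiv ℝ f x v i := by
  rw [fderiv_apply ((hf.differentiable (by norm_num)) x)]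
  rfl

theorem fderiv_constraintMap_apply (hH : ContDiff ℝ 1 P.H) (hG : ContDiff ℝ 1 P.G)
    (I : Finset (Fin mG)) (x v : Eucl n) :
    fderiv ℝ (P.constraintMap I) x v = Sum.elim (P.dH x v) fun l : {l // l ∈ I} => P.dG x v l := by
  ext i
  have h := fderiv_apply (((contDiff_constraintMap hH hG I).differentiable (by norm_num)) x) i
  have h' : fderiv ℝ (P.constraintMap I) x v i
      = fderiv ℝ (fun y => P.constraintMap I y i) x v := by rw [h]; rfl
  rw [h']
  cases i with
  | inl j => exact fderiv_comp_apply hH x v j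
  | inr l => exact fderiv_comp_apply hG x v l

theorem surjective_fderiv_constraintMap (hH : ContDiff ℝ 1 P.H) (hG : ContDiff ℝ 1 P.G)
    (hind : P.LinearIndependentGradients) {x : Eucl n} (hx : x ∈ P.N) {I : Finset (Fin mG)}
    (hI : I ⊆ P.active 0 x) : Function.Surjective (fderiv ℝ (P.constraintMap I) x) := by
  have h := (hind x hx).comp
    (Sum.map id fun l : {l // l ∈ I} => (⟨l, hI l.2⟩ : {l // l ∈ P.active 0 x}))
    (Function.injective_id.sumMap fun a b hab => Subtype.ext (by simpa using hab))
  refine fun y => (h.surjective_pi y).imp fun v hv => ?_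
  rw [← hv, fderiv_constraintMap_apply hH hG]
  ext i
  cases i with
  | inl j => exact (fderiv_comp_apply hH x v j).symm
  | inr l => exact (fderiv_comp_apply hG x v l).symm

theorem MI_empty : P.MI ∅ = P.M := by
  simp [MI]

theorem mem_MI_active {x : Eucl n} (hx : x ∈ P.N) : x ∈ P.MI (P.active 0 x) :=
  ⟨hx.1, fun l hl => le_antisymm (hx.2 l) (by simpa [active] using hl)⟩

theorem isClosed_N (hH : Continuous P.H) (hG : Continuous P.G) : IsClosed P.N := by
  have h : P.N = {x | P.H x = 0} ∩ ⋂ l, {x | P.G x l ≤ 0} := by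
    ext x
    simp [N, M]
  rw [h]
  exact (isClosed_eq hH continuous_const).inter (isClosed_iInter fun l =>
    isClosed_le ((continuous_apply l).comp hG) continuous_const)

/-- Being inactive is an open condition, so nearby subproblems (SP1) impose no constraint index that
is absent at `a`. -/
theorem eventually_active_subset (hG : Continuous P.G) (ε : ℝ) (a : Eucl n) :
    ∀ᶠ x in 𝓝 a, P.active ε x ⊆ P.active ε a := by
  have h : ∀ l, ∀ᶠ x in 𝓝 a, l ∈ P.active ε x → l ∈ P.active ε a := by
    intro l
    by_cases hl : l ∈ P.active ε a
    · exact Eventually.of_forall fun _ _ => hl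
    · have hl' : P.G a l < -ε := by simpa [active] using hl
      filter_upwards [((continuous_apply l).comp hG).continuousAt.eventually_lt
        continuousAt_const hl'] with x hx hmem
      exact absurd hx (not_lt.2 (by simpa [active] using hmem))
  exact (eventually_all.2 h).mono fun x hx l => hx l

/-! ### Subproblem values and bounds on directions -/

theorem zero_mem_sp1Feasible (x : Eucl n) (ε : ℝ) : (0 : Eucl n × ℝ) ∈ P.sp1Feasible x ε := by
  simp [sp1Feasible, dF, dG, dH]

theorem zero_mem_sp2Feasible (x : Eucl n) : (0 : Eucl n × ℝ) ∈ P.sp2Feasible x := by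
  simp [sp2Feasible, dF, dG, dH]

theorem exists_sp1Feasible_neg {x : Eucl n} {ε : ℝ} (h : P.alpha1 x ε ≠ 0) :
    ∃ p ∈ P.sp1Feasible x ε, spObj p < 0 := by
  by_contra! hc
  refine h (IsLeast.csInf_eq ⟨⟨0, zero_mem_sp1Feasible x ε, by simp [spObj]⟩, ?_⟩)
  rintro _ ⟨p, hp, rfl⟩
  exact hc p hp

/-- Near a feasible point where `α₁` does not vanish, the solutions of (SP1) have objective values
uniformly bounded away from zero. -/
theorem eventually_spObj_le (hF : ContDiff ℝ 1 P.F) (hH : ContDiff ℝ 1 P.H)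
    (hG : ContDiff ℝ 1 P.G) (hreg : P.RegularH) {a : Eucl n} (ha : a ∈ P.M) {ε : ℝ}
    (h : P.alpha1 a ε ≠ 0) :
    ∃ δ > 0, ∀ᶠ x in 𝓝 a, ∀ p, IsMinOn spObj (P.sp1Feasible x ε) p → spObj p ≤ -δ := by
  obtain ⟨⟨w, b⟩, ⟨hwF, hwG, hwH⟩, hneg⟩ := exists_sp1Feasible_neg h
  simp only [spObj] at hneg hwF hwG hwH
  obtain ⟨W, hW, hWa, hWker⟩ := hH.exists_continuousAt_ker_fderiv (hreg a ha)
    (w := w) (funext hwH)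
  -- The value at `a` is `-3δ`; one `δ` pays for relaxing `b`, one for the change of norm, and `-δ`
  -- remains.
  set δ := -(b + ‖w‖ ^ 2 / 2) / 3 with hδ
  have hδ0 : 0 < δ := by linarith
  have hcomp : ∀ {k : ℕ} {f : Eucl n → Fin k → ℝ}, ContDiff ℝ 1 f → ∀ i,
      fderiv ℝ f a w i ≤ b → ∀ᶠ x in 𝓝 a, fderiv ℝ f x (W x) i ≤ b + δ := by
    intro k f hf i hi
    have hcont : ContinuousAt (fun x => fderiv ℝ f x (W x) i) a :=
      (continuous_apply i).continuousAt.comp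
        ((hf.continuous_fderiv (by norm_num)).continuousAt.clm_apply hW)
    refine (hcont.eventually_lt (continuousAt_const (y := b + δ)) ?_).mono fun x hx => hx.le
    rw [hWa]
    linarith
  have hnorm : ∀ᶠ x in 𝓝 a, ‖W x‖ ^ 2 / 2 < ‖w‖ ^ 2 / 2 + δ :=
    ((hW.norm.pow 2).div_const 2).eventually_lt continuousAt_const (by simpa [hWa] using hδ0)
  have hGev : ∀ᶠ x in 𝓝 a, ∀ l ∈ P.active ε a, P.dG x (W x) l ≤ b + δ :=
    (eventually_all_finset _).2 fun l hl => hcomp hG l (hwG l hl)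
  refine ⟨δ, hδ0, ?_⟩
  filter_upwards [eventually_all.2 fun i => hcomp hF i (hwF i), hGev, hnorm, hWker,
    eventually_active_subset hG.continuous ε a] with x hxF hxG hxn hxH hxA p hp
  have hfeas : (W x, b + δ) ∈ P.sp1Feasible x ε :=
    ⟨hxF, fun l hl => hxG l (hxA hl), fun j => congrFun hxH j⟩
  refine (hp hfeas).trans ?_
  simp only [spObj]
  linarith

/-- A direction along which the objectives decrease at rate `½ ‖v‖²` is bounded by twice the norm of
the derivative. -/
theorem norm_le_of_dF_le {x v : Eucl n} {b : ℝ} {i : Fin m}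
    (hi : P.dF x v i ≤ b) (hb : spObj (v, b) ≤ 0) :
    ‖v‖ ≤ 2 * ‖fderiv ℝ P.F x‖ := by
  simp only [spObj] at hb
  have h1 : |P.dF x v i| ≤ ‖fderiv ℝ P.F x‖ * ‖v‖ :=
    (norm_le_pi_norm (fderiv ℝ P.F x v) i).trans ((fderiv ℝ P.F x).le_opNorm v)
  have h2 := neg_le_of_abs_le h1
  have h3 : ‖v‖ * ‖v‖ ≤ 2 * ‖fderiv ℝ P.F x‖ * ‖v‖ := by nlinarith
  rcases (norm_nonneg v).eq_or_lt with h | h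
  · rw [← h]; positivity
  · exact le_of_mul_le_mul_right h3 h

theorem eventually_norm_fderiv_le {f : Eucl n → Fin m → ℝ} (hf : ContDiff ℝ 1 f) (a : Eucl n) :
    ∀ᶠ x in 𝓝 a, 2 * ‖fderiv ℝ f x‖ ≤ 2 * (‖fderiv ℝ f a‖ + 1) := by
  refine (((hf.continuous_fderiv (by norm_num)).continuousAt.norm).eventually_lt
    (continuousAt_const (y := ‖fderiv ℝ f a‖ + 1)) (by simp)).mono fun x hx => ?_
  linarith

/-! ### Uniform thresholds for Armijo and feasibility -/

/-- Along steep descent directions in the kernel of the constraint derivative, the Armijo condition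
holds for uniformly small step lengths. -/
theorem eventually_armijo (hF : ContDiff ℝ 1 P.F) (hH : ContDiff ℝ 1 P.H)
    (hG : ContDiff ℝ 1 P.G) {I : Finset (Fin mG)} {a : Eucl n} (ha : a ∈ P.MI I)
    (hsurj : Function.Surjective (fderiv ℝ (P.constraintMap I) a)) {p : Eucl n → Eucl n}
    (hp : IsProjectionOnto (P.MI I) p) {σ δ R : ℝ} (hσ : σ < 1) (hδ : 0 < δ) (hR : 0 < R) :
    ∃ τ > 0, ∀ᶠ x in 𝓝 a, x ∈ P.MI I → ∀ v, ‖v‖ ≤ R → (∀ j, P.dH x v j = 0) →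
      (∀ l ∈ I, P.dG x v l = 0) → (∀ i, P.dF x v i ≤ -δ) →
      ∀ t, 0 < t → t ≤ τ → P.Armijo σ p x v t := by
  -- The Armijo slack is at least `(1 - σ) δ t`; an error of half that size keeps the inequality
  -- strict.
  have key : ∀ i, ∃ τ > 0, ∀ᶠ x in 𝓝 a, P.constraintMap I x = 0 → ∀ v, ‖v‖ ≤ R →
      fderiv ℝ (P.constraintMap I) x v = 0 → ∀ t, 0 < t → t ≤ τ →
      |P.F (p (x + t • v)) i - P.F x i - t * fderiv ℝ (fun y => P.F y i) x v|
        ≤ (1 - σ) * δ / 2 * t := fun i =>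
    (contDiff_constraintMap hH hG I).eventually_abs_sub_sub_fderiv_le_of_proj hsurj
      (constraintMap_eq_zero_iff.2 ha)
      (fun y z hz => (hp y).2 z (constraintMap_eq_zero_iff.1 hz)) (contDiff_pi.1 hF i)
      (by have := sub_pos.2 hσ; positivity) hR
  choose τ hτ hev using key
  obtain ⟨τ₀, hτ₀, hle⟩ : ∃ τ₀ > 0, ∀ i, τ₀ ≤ τ i :=
    exists_pos_forall_le hτ
  refine ⟨τ₀, hτ₀, ?_⟩
  filter_upwards [eventually_all.2 hev] with x hx hxI v hv hvH hvG hvF t ht htτ i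
  have h := hx i (constraintMap_eq_zero_iff.2 hxI) v hv (by
    rw [fderiv_constraintMap_apply hH hG]
    ext i
    cases i with
    | inl j => exact hvH j
    | inr l => exact hvG l l.2) t ht (htτ.trans (hle i))
  rw [fderiv_comp_apply hF] at h
  have h1 := (abs_le.1 h).2
  have h2 : (1 - σ) * t * (P.dF x v i + δ) ≤ 0 :=
    mul_nonpos_of_nonneg_of_nonpos (mul_nonneg (sub_pos.2 hσ).le ht.le) (by linarith [hvF i])
  have h3 : 0 < (1 - σ) * δ * t := by have := sub_pos.2 hσ; positivity
  change P.F (p (x + t • v)) i - P.F x i - t * P.dF x v i ≤ _ at h1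
  nlinarith

end MOP

namespace MOP

variable {n m mH mG : ℕ} {P : MOP n m mH mG}

/-- Along directions that decrease all `ε`-active constraints, uniformly small projected steps from
feasible points stay feasible. -/
theorem eventually_proj_mem_N (hH : ContDiff ℝ 1 P.H) (hG : ContDiff ℝ 1 P.G)
    {a : Eucl n} (ha : a ∈ P.MI ∅)
    (hsurj : Function.Surjective (fderiv ℝ (P.constraintMap ∅) a)) {p : Eucl n → Eucl n}
    (hp : IsProjectionOnto (P.MI ∅) p) {ε δ R : ℝ} (hε : 0 < ε) (hδ : 0 < δ) (hR : 0 < R) :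
    ∃ τ > (0 : ℝ), ∀ᶠ x in 𝓝 a, x ∈ P.N → ∀ v, ‖v‖ ≤ R → (∀ j, P.dH x v j = 0) →
      (∀ l ∈ P.active ε x, P.dG x v l ≤ -δ) →
      ∀ t, 0 < t → t ≤ τ → p (x + t • v) ∈ P.N := by
  have key : ∀ l, ∃ τ > 0, ∀ᶠ x in 𝓝 a, P.constraintMap ∅ x = 0 → ∀ v, ‖v‖ ≤ R →
      fderiv ℝ (P.constraintMap ∅) x v = 0 → ∀ t, 0 < t → t ≤ τ →
      |P.G (p (x + t • v)) l - P.G x l - t * fderiv ℝ (fun y => P.G y l) x v| ≤ δ * t := fun l =>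
    (contDiff_constraintMap hH hG ∅).eventually_abs_sub_sub_fderiv_le_of_proj hsurj
      (constraintMap_eq_zero_iff.2 ha)
      (fun y z hz => (hp y).2 z (constraintMap_eq_zero_iff.1 hz)) (contDiff_pi.1 hG l) hδ hR
  choose τ hτ hev using key
  obtain ⟨τ₀, hτ₀, hle⟩ := exists_pos_forall_le hτ
  set D := ‖fderiv ℝ P.G a‖ + 1 with hD
  have hD0 : 0 < D := by positivity
  -- For `ε`-active constraints the slope `-δ` absorbs the error `δ t`. The others start below `-ε`
  -- and grow by at most `(D R + δ) t`.
  refine ⟨min τ₀ (ε / (D * R + δ)), by positivity, ?_⟩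
  filter_upwards [eventually_all.2 hev, eventually_norm_fderiv_le hG a] with x hx hxD hxN v hv hvH
    hvG t ht htτ
  refine ⟨(hp _).1.1, fun l => ?_⟩
  have hxI : x ∈ P.MI ∅ := by rw [MI_empty]; exact hxN.1
  have h := hx l (constraintMap_eq_zero_iff.2 hxI) v hv (by
    rw [fderiv_constraintMap_apply hH hG]
    ext i
    cases i with
    | inl j => exact hvH j
    | inr l => exact absurd l.2 (Finset.notMem_empty _)) t ht
      (htτ.trans ((min_le_left _ _).trans (hle l)))
  rw [fderiv_comp_apply hG] at h
  have h1 := (abs_le.1 h).2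
  change P.G (p (x + t • v)) l - P.G x l - t * P.dG x v l ≤ _ at h1
  by_cases hl : l ∈ P.active ε x
  · nlinarith [hvG l hl, hxN.2 l]
  · have hl' : P.G x l < -ε := by simpa [active] using hl
    have htε : t * (D * R + δ) ≤ ε := by
      rw [← le_div_iff₀ (by positivity)]
      exact htτ.trans (min_le_right _ _)
    have hdG : P.dG x v l ≤ D * R := by
      calc P.dG x v l ≤ ‖fderiv ℝ P.G x v‖ :=
            (le_abs_self _).trans (norm_le_pi_norm (fderiv ℝ P.G x v) l)
        _ ≤ ‖fderiv ℝ P.G x‖ * ‖v‖ := (fderiv ℝ P.G x).le_opNorm v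
        _ ≤ D * R := by gcongr; linarith
    nlinarith

/-! ### Step lengths and decrease per iteration -/

theorem IsStep1.spec {A : AlgParams} (hβ₀ : 0 < A.β₀) (hβ : 0 < A.β) {p : Eucl n → Eucl n}
    {x v : Eucl n} {t : ℝ} (h : P.IsStep1 A p x v t) :
    0 < t ∧ P.Armijo A.σ p x v t ∧ p (x + t • v) ∈ P.N := by
  obtain ⟨k₀, hk₀, ⟨hN, rfl⟩ | ⟨-, k, -, ht, hN, hA⟩⟩ := h
  · exact ⟨by positivity, hk₀.1, hN⟩
  · exact ⟨lt_of_lt_of_le (by positivity) ht.1, hA, hN⟩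

theorem IsStep2.spec {A : AlgParams} (hβ₀ : 0 < A.β₀) (hβ : 0 < A.β) {p : Eucl n → Eucl n}
    {x v : Eucl n} {t : ℝ} (h : P.IsStep2 A p x v t) :
    0 < t ∧ P.Armijo A.σ p x v t ∧ p (x + t • v) ∈ P.N := by
  obtain ⟨k₀, hk₀, ⟨hN, rfl⟩ | ⟨-, ht, -, hN, -, hA⟩⟩ := h
  · exact ⟨by positivity, hk₀.1, hN⟩
  · exact ⟨ht, hA, hN⟩

/-- Step lengths of Strategy 1 are bounded below by the threshold of acceptance. -/
theorem IsStep1.min_le {A : AlgParams} (hβ₀ : 0 < A.β₀) (hβ : 0 < A.β) {p : Eucl n → Eucl n}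
    {x v : Eucl n} {t τ : ℝ} (h : P.IsStep1 A p x v t)
    (hA : ∀ t, 0 < t → t ≤ τ → P.Armijo A.σ p x v t)
    (hN : ∀ t, 0 < t → t ≤ τ → p (x + t • v) ∈ P.N) : min A.β₀ (A.β * τ) ≤ t := by
  obtain ⟨k₀, hk₀, ⟨-, rfl⟩ | ⟨-, k, hk, ht, -, -⟩⟩ := h
  · exact hk₀.min_le_mul_pow (Q := P.Armijo A.σ p x v) hβ₀ hβ hA
  · exact (hk.min_le_mul_pow (Q := fun t => P.Armijo A.σ p x v t ∧ p (x + t • v) ∈ P.N) hβ₀ hβ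
      fun t h0 h1 => ⟨hA t h0 h1, hN t h0 h1⟩).trans ht.1

/-- Step lengths of Strategy 2 that are below the threshold of acceptance activate further
constraints. -/
theorem IsStep2.min_le_or {A : AlgParams} (hβ₀ : 0 < A.β₀) (hβ : 0 < A.β)
    {p : Eucl n → Eucl n} {x v : Eucl n} {t τ : ℝ} (h : P.IsStep2 A p x v t)
    (hA : ∀ t, 0 < t → t ≤ τ → P.Armijo A.σ p x v t) :
    min A.β₀ (A.β * τ) ≤ t ∨ (P.active 0 x).card < (P.active 0 (p (x + t • v))).card := by
  obtain ⟨k₀, hk₀, ⟨-, rfl⟩ | ⟨-, -, -, -, hc, -⟩⟩ := h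
  · exact Or.inl (hk₀.min_le_mul_pow (Q := P.Armijo A.σ p x v) hβ₀ hβ hA)
  · exact Or.inr hc

theorem IsSolSP1.exists_nonpos {x v : Eucl n} {ε : ℝ} (h : P.IsSolSP1 x ε v) :
    ∃ b, (v, b) ∈ P.sp1Feasible x ε ∧ IsMinOn spObj (P.sp1Feasible x ε) (v, b) ∧
      spObj (v, b) ≤ 0 := by
  obtain ⟨b, hb, hmin⟩ := h
  exact ⟨b, hb, hmin, (hmin (zero_mem_sp1Feasible x ε)).trans (by simp [spObj])⟩

theorem IsSolSP2.exists_eq_alpha2 {x v : Eucl n} (h : P.IsSolSP2 x v) :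
    ∃ b, (v, b) ∈ P.sp2Feasible x ∧ spObj (v, b) = P.alpha2 x ∧ spObj (v, b) ≤ 0 := by
  obtain ⟨b, hb, hmin⟩ := h
  have hleast : IsLeast (spObj '' P.sp2Feasible x) (spObj (v, b)) := ⟨⟨_, hb, rfl⟩, ?_⟩
  · exact ⟨b, hb, hleast.csInf_eq.symm,
      (hmin (zero_mem_sp2Feasible x)).trans (by simp [spObj])⟩
  rintro _ ⟨p, hp, rfl⟩
  exact hmin hp

theorem le_spObj (v : Eucl n) (b : ℝ) : b ≤ spObj (v, b) := by
  simp only [spObj]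
  linarith [sq_nonneg ‖v‖]

/-- Bounds `c` on the step and `μ` on the slope that do not depend on the iterate give a fixed
decrease; `c = μ = 0` gives monotonicity. -/
theorem Armijo.le_sub {σ : ℝ} {p : Eucl n → Eucl n} {x v : Eucl n} {t : ℝ} {i : Fin m}
    (h : P.Armijo σ p x v t) (hσ : 0 < σ) {c μ : ℝ} (hc : 0 ≤ c) (hct : c ≤ t) (hμ : 0 ≤ μ)
    (hv : P.dF x v i ≤ -μ) : P.F (p (x + t • v)) i ≤ P.F x i - σ * (c * μ) := by
  have h1 : c * μ ≤ t * -P.dF x v i := mul_le_mul hct (by linarith) hμ (hc.trans hct)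
  have h2 := mul_le_mul_of_nonneg_left h1 hσ.le
  have h3 := h i
  linarith

theorem Iteration.mem_N_and_le {A : AlgParams} (hβ₀ : 0 < A.β₀) (hβ : 0 < A.β) (hσ : 0 < A.σ)
    {π : Eucl n → Eucl n} {πI : Finset (Fin mG) → Eucl n → Eucl n} {x y : Eucl n}
    (h : P.Iteration A π πI x (some y)) : y ∈ P.N ∧ ∀ i, P.F y i ≤ P.F x i := by
  cases h with
  | strategy1 v t h₂ h₁ hv ht =>
    obtain ⟨b, hb, -, h0⟩ := hv.exists_nonpos
    obtain ⟨ht0, hA, hN⟩ := ht.spec hβ₀ hβ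
    refine ⟨hN, fun i => ?_⟩
    simpa using hA.le_sub (i := i) hσ le_rfl ht0.le le_rfl
      (by simpa using (hb.1 i).trans ((le_spObj v b).trans h0))
  | strategy2 v t h₂ hv ht =>
    obtain ⟨b, hb, -, h0⟩ := hv.exists_eq_alpha2
    obtain ⟨ht0, hA, hN⟩ := ht.spec hβ₀ hβ
    refine ⟨hN, fun i => ?_⟩
    simpa using hA.le_sub (i := i) hσ le_rfl ht0.le le_rfl
      (by simpa using (hb.1 i).trans ((le_spObj v b).trans h0))

/-- Near a feasible point where `α₁` does not vanish, every iteration decreases the objectives by a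
fixed amount or moves to a nearby point with more active constraints. -/
theorem eventually_iteration_decrease (hF : ContDiff ℝ 1 P.F) (hH : ContDiff ℝ 1 P.H)
    (hG : ContDiff ℝ 1 P.G) (hreg : P.RegularH) (hind : P.LinearIndependentGradients)
    {π : Eucl n → Eucl n} (hπ : IsProjectionOnto P.M π)
    {πI : Finset (Fin mG) → Eucl n → Eucl n}
    (hπI : ∀ I, (P.MI I).Nonempty → IsProjectionOnto (P.MI I) (πI I))
    {A : AlgParams} (hβ₀ : 0 < A.β₀) (hβ : A.β ∈ Set.Ioo (0 : ℝ) 1)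
    (hσ : A.σ ∈ Set.Ioo (0 : ℝ) 1) (hε : 0 < A.ε) (hη : 0 < A.η)
    {a : Eucl n} (ha : a ∈ P.N) (hα : P.alpha1 a A.ε ≠ 0) (i : Fin m)
    {U : Set (Eucl n)} (hU : U ∈ 𝓝 a) :
    ∃ ρ > 0, ∀ᶠ x in 𝓝 a, x ∈ P.N → ∀ y, P.Iteration A π πI x (some y) →
      P.F y i ≤ P.F x i - ρ ∨ (y ∈ U ∧ (P.active 0 x).card < (P.active 0 y).card) := by
  obtain ⟨δ, hδ, hev⟩ := eventually_spObj_le hF hH hG hreg ha.1 hα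
  set R := 2 * (‖fderiv ℝ P.F a‖ + 1)
  have hR : 0 < R := by positivity
  have ha0 : a ∈ P.MI ∅ := by rw [MI_empty]; exact ha.1
  have hs0 := surjective_fderiv_constraintMap hH hG hind ha (Finset.empty_subset _)
  rw [← MI_empty] at hπ
  obtain ⟨τ₁, hτ₁, hA₁⟩ := eventually_armijo hF hH hG ha0 hs0 hπ hσ.2 hδ hR
  obtain ⟨τ₂, hτ₂, hN₂⟩ := eventually_proj_mem_N hH hG ha0 hs0 hπ hε hδ hR
  -- The active set varies with `x` but takes finitely many values, so one threshold serves all; a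
  -- dummy `1` covers sets that do not occur near `a`.
  have h3 : ∀ I : Finset (Fin mG), ∃ τ > 0, I ⊆ P.active 0 a → ∀ᶠ x in 𝓝 a, x ∈ P.MI I →
      ∀ v, ‖v‖ ≤ R → (∀ j, P.dH x v j = 0) → (∀ l ∈ I, P.dG x v l = 0) →
      (∀ i, P.dF x v i ≤ -A.η) → ∀ t, 0 < t → t ≤ τ → P.Armijo A.σ (πI I) x v t := by
    intro I
    by_cases hI : I ⊆ P.active 0 a
    · have haI : a ∈ P.MI I := ⟨ha.1, fun l hl => (mem_MI_active ha).2 l (hI hl)⟩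
      obtain ⟨τ, hτ, h⟩ := eventually_armijo hF hH hG haI
        (surjective_fderiv_constraintMap hH hG hind ha hI) (hπI I ⟨a, haI⟩) hσ.2 hη hR
      exact ⟨τ, hτ, fun _ => h⟩
    · exact ⟨1, one_pos, fun h => absurd h hI⟩
  choose τ₃ hτ₃ hA₃ using h3
  obtain ⟨τ₄, hτ₄, hle⟩ := exists_pos_forall_le hτ₃
  obtain ⟨r, hr, hrU⟩ := Metric.mem_nhds_iff.1 hU
  obtain ⟨τ, hτ, hle₁, hle₂, hle₄⟩ : ∃ τ > 0, τ ≤ τ₁ ∧ τ ≤ τ₂ ∧ τ ≤ τ₄ :=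
    ⟨min τ₁ (min τ₂ τ₄), by positivity, min_le_left _ _,
      (min_le_right _ _).trans (min_le_left _ _), (min_le_right _ _).trans (min_le_right _ _)⟩
  have hβ' := hβ.1
  have hσ' := hσ.1
  -- A projected step with `t < c` moves at most `2 t R < r / 2`, so from within `r / 2` of `a` it
  -- lands in `U`.
  obtain ⟨c, hc, hcτ, hcr⟩ : ∃ c > 0, c ≤ min A.β₀ (A.β * τ) ∧ c ≤ r / (4 * R) :=
    ⟨min (min A.β₀ (A.β * τ)) (r / (4 * R)), by positivity, min_le_left _ _, min_le_right _ _⟩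
  refine ⟨A.σ * (c * min δ A.η), by positivity, ?_⟩
  filter_upwards [hev, hA₁, hN₂, eventually_all.2 fun I => eventually_imp_distrib_left.2 (hA₃ I),
    eventually_norm_fderiv_le hF a, eventually_active_subset hG.continuous 0 a,
    Metric.ball_mem_nhds a (half_pos hr)] with x hxev hxA₁ hxN₂ hxA₃ hxF hxact hxa hxN y hy
  have hμ : 0 ≤ min δ A.η := by positivity
  cases hy with
  | strategy1 v t h₂ h₁ hv ht =>
    left
    obtain ⟨b, hb, hmin, h0⟩ := hv.exists_nonpos
    have hvR : ‖v‖ ≤ R := (norm_le_of_dF_le (hb.1 i) h0).trans hxF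
    have hbδ : b ≤ -δ := (le_spObj v b).trans (hxev _ hmin)
    have hx0 : x ∈ P.MI ∅ := by rw [MI_empty]; exact hxN.1
    have hdF : ∀ i, P.dF x v i ≤ -δ := fun i => (hb.1 i).trans hbδ
    have htc := ht.min_le hβ₀ hβ.1 (τ := τ)
      (fun t h0 h1 => hxA₁ hx0 v hvR hb.2.2 (fun l hl => absurd hl (Finset.notMem_empty _)) hdF
        t h0 (h1.trans hle₁))
      (fun t h0 h1 => hxN₂ hxN v hvR hb.2.2 (fun l hl => (hb.2.1 l hl).trans hbδ)
        t h0 (h1.trans hle₂))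
    exact (ht.spec hβ₀ hβ.1).2.1.le_sub hσ.1 hc.le (hcτ.trans htc) hμ
      ((hdF i).trans (neg_le_neg (min_le_left _ _)))
  | strategy2 v t h₂ hv ht =>
    obtain ⟨b, hb, hbα, h0⟩ := hv.exists_eq_alpha2
    have hvR : ‖v‖ ≤ R := (norm_le_of_dF_le (hb.1 i) h0).trans hxF
    have hbη : b ≤ -A.η := (le_spObj v b).trans (hbα.le.trans h₂)
    have hdF : ∀ i, P.dF x v i ≤ -A.η := fun i => (hb.1 i).trans hbη
    have hxI := mem_MI_active hxN
    obtain ⟨ht0, hA, -⟩ := ht.spec hβ₀ hβ.1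
    by_cases hct : c ≤ t
    · exact Or.inl (hA.le_sub hσ.1 hc.le hct hμ ((hdF i).trans (neg_le_neg (min_le_right _ _))))
    · push Not at hct
      right
      refine ⟨hrU ?_, (ht.min_le_or hβ₀ hβ.1 (τ := τ) fun t h0 h1 =>
        hxA₃ _ hxact hxI v hvR hb.2.1 hb.2.2 hdF t h0
          (h1.trans (hle₄.trans (hle _)))).resolve_left (not_le.2 (hct.trans_le hcτ))⟩
      set q := πI (P.active 0 x) (x + t • v)
      -- `x` itself competes in the projection onto `M_I`.
      have hq : ‖q - (x + t • v)‖ ≤ ‖x - (x + t • v)‖ := (hπI _ ⟨x, hxI⟩ _).2 x hxI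
      have htv : ‖t • v‖ ≤ t * R := by
        rw [norm_smul, Real.norm_of_nonneg ht0.le]
        gcongr
      have htr : t * (4 * R) < r := by
        rw [← lt_div_iff₀ (by positivity)]
        exact hct.trans_le hcr
      rw [sub_add_cancel_left, norm_neg] at hq
      rw [Metric.mem_ball, dist_eq_norm] at hxa ⊢
      have e : q - a = (q - (x + t • v)) + t • v + (x - a) := by abel
      rw [e]
      refine norm_add₃_le.trans_lt ?_
      linarith

theorem alpha1_eq_zero_of_mapClusterPt (hF : ContDiff ℝ 1 P.F) (hH : ContDiff ℝ 1 P.H)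
    (hG : ContDiff ℝ 1 P.G) (hreg : P.RegularH) (hind : P.LinearIndependentGradients)
    {π : Eucl n → Eucl n} (hπ : IsProjectionOnto P.M π)
    {πI : Finset (Fin mG) → Eucl n → Eucl n}
    (hπI : ∀ I, (P.MI I).Nonempty → IsProjectionOnto (P.MI I) (πI I))
    {A : AlgParams} (hβ₀ : 0 < A.β₀) (hβ : A.β ∈ Set.Ioo (0 : ℝ) 1)
    (hσ : A.σ ∈ Set.Ioo (0 : ℝ) 1) (hε : 0 < A.ε) (hη : 0 < A.η) (i : Fin m)
    {x : ℕ → Eucl n} (hx0 : x 0 ∈ P.N) (hx : ∀ l, P.Iteration A π πI (x l) (some (x (l + 1))))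
    {a : Eucl n} (ha : MapClusterPt a atTop x) : P.alpha1 a A.ε = 0 := by
  by_contra hα
  have hstep := fun l => (hx l).mem_N_and_le hβ₀ hβ.1 hσ.1
  have hN : ∀ l, x l ∈ P.N := fun l => by
    cases l with
    | zero => exact hx0
    | succ l => exact (hstep l).1
  have haN : a ∈ P.N := (isClosed_N hH.continuous hG.continuous).mem_of_mapClusterPt ha
    (Eventually.of_forall hN)
  have hanti : Antitone fun l => P.F (x l) i := antitone_nat_of_succ_le fun l => (hstep l).2 i
  have hclF : MapClusterPt (P.F a i) atTop fun l => P.F (x l) i :=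
    ha.continuousAt_comp ((continuous_apply i).comp hF.continuous).continuousAt
  -- All neighbourhoods are needed: the induction step applies the hypothesis to the one on which
  -- the dichotomy for `U` holds.
  have key : ∀ c : ℕ, ∀ U ∈ 𝓝 a, ∃ᶠ l in atTop, x l ∈ U ∧ c ≤ (P.active 0 (x l)).card := by
    intro c
    induction c with
    | zero => exact fun U hU => by simpa using mapClusterPt_iff_frequently.1 ha U hU
    | succ c ih =>
      intro U hU
      obtain ⟨ρ, hρ, hev⟩ := eventually_iteration_decrease hF hH hG hreg hind hπ hπI hβ₀ hβ hσ hε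
        hη haN hα i hU
      refine (tendsto_add_atTop_nat 1).frequently
        (((ih _ hev).and_eventually (hanti.eventually_sub_succ_lt hclF hρ)).mono ?_)
      rintro l ⟨⟨hl, hcard⟩, hlt⟩
      rcases hl (hN l) _ (hx l) with h | ⟨hU', hcard'⟩
      · linarith
      · exact ⟨hU', by omega⟩
  obtain ⟨l, -, hl⟩ := (key (mG + 1) Set.univ univ_mem).exists
  have := (P.active 0 (x l)).card_le_univ
  rw [Fintype.card_fin] at this
  omega

end MOP

theorem mainTheorem3 {n m mH mG : ℕ} (hm : 0 < m) (P : MOP n m mH mG)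
    (hF : ContDiff ℝ 2 P.F) (hH : ContDiff ℝ 2 P.H) (hG : ContDiff ℝ 2 P.G)
    (hreg : P.RegularH) (hcone : P.LinearizedConeInterior)
    (hind : P.LinearIndependentGradients)
    (π : Eucl n → Eucl n) (hπ : IsProjectionOnto P.M π)
    (πI : Finset (Fin mG) → Eucl n → Eucl n)
    (hπI : ∀ I, (P.MI I).Nonempty → IsProjectionOnto (P.MI I) (πI I))
    (A : AlgParams) (hβ₀ : 0 < A.β₀) (hβ : A.β ∈ Set.Ioo (0 : ℝ) 1)
    (hσ : A.σ ∈ Set.Ioo (0 : ℝ) 1) (hε : 0 < A.ε) (hη : 0 < A.η) (z : Eucl n) :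
    (∀ x : ℕ → Eucl n, P.GeneratesInfinite A π πI z x →
      ∀ xbar : Eucl n, MapClusterPt xbar atTop x → P.alpha1 xbar A.ε = 0) ∧
    (∀ (x : ℕ → Eucl n) (L : ℕ), P.GeneratesFinite A π πI z x L →
      P.alpha1 (x L) A.ε = 0) := by
  refine ⟨fun x hx a ha => ?_, fun x L hx => ?_⟩
  · exact MOP.alpha1_eq_zero_of_mapClusterPt (hF.of_le (by norm_num)) (hH.of_le (by norm_num))
      (hG.of_le (by norm_num)) hreg hind hπ hπI hβ₀ hβ hσ hε hη ⟨0, hm⟩ hx.1.1 hx.2 ha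
  · obtain ⟨-, -, hlast⟩ := hx
    cases hlast with
    | terminate h₂ h₁ => exact h₁
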